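/- Let $k>0$, let $V\subset\mathbb R^3$ be a bounded open set, and let $\chi\in\mathbb C$ with $\chi\notin(-\infty,-1]$. For $\boldsymbol E\in L^2(V;\mathbb C^3)$, extended by zero to $\mathbb R^3$, put $\tilde{\boldsymbol E}(\boldsymbol q)=\int_V \boldsymbol E(\boldsymbol r)e^{i\boldsymbol q\cdot\boldsymbol r}\,d^3\boldsymbol r$, and define $$(\hat{\mathcal D}\boldsymbol E)(\boldsymbol r)=-\frac1{(2\pi)^3}\int_{\mathbb R^3}\frac{\boldsymbol q\times[\boldsymbol q\times\tilde{\boldsymbol E}(\boldsymbol q)]}{|\boldsymbol q|^2}\,e^{-i\boldsymbol q\cdot\boldsymbol r}\,d^3\boldsymbol q,$$ the integral being the inverse Fourier--Plancherel transform on $L^2(\mathbb R^3;\mathbb C^3)$, and $$(\hat\gamma\boldsymbol E)(\boldsymbol r)=\int_V\left(\frac{k^2e^{-ik|\boldsymbol r-\boldsymbol r'|}}{4\pi|\boldsymbol r-\boldsymbol r'|}\,\mathbb 1+\nabla\nabla\frac{e^{-ik|\boldsymbol r-\boldsymbol r'|}-1}{4\pi|\boldsymbol r-\boldsymbol r'|}\right)\boldsymbol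 E(\boldsymbol r')\,d^3\boldsymbol r',$$ where $\mathbb 1$ is the $3\times3$ identity matrix and $\nabla\nabla$ denotes the Hessian matrix with respect to $\boldsymbol r$. Then the Born operator $$\hat{\mathcal B}=(1+\chi)\hat I-\chi\hat{\mathcal D}-\chi\hat\gamma:\ L^2(V;\mathbb C^3)\longrightarrow L^2(V;\mathbb C^3)$$ (with $\hat{\mathcal D}\boldsymbol E$ restricted to $V$) is a bounded Fredholm operator of index zero: its range is closed, $\ker\hat{\mathcal B}$ and $(\operatorname{ran}\hat{\mathcal B})^\perp$ are finite-dimensional, and $\dim\ker\hat{\mathcal B}=\dim(\operatorname{ran}\hat{\mathcal B})^\perp$. -/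

import Mathlib

open MeasureTheory

open scoped Matrix

noncomputable section

namespace BornScattering

/-- Physical space `ℝ³`. -/
abbrev R3 : Type := EuclideanSpace ℝ (Fin 3)

/-- The space `ℂ³` of values of the fields. -/
abbrev C3 : Type := EuclideanSpace ℂ (Fin 3)

/-- The Hilbert space `L²(V; ℂ³)`. -/
abbrev L2 (V : Set R3) : Type := Lp C3 2 ((volume : Measure R3).restrict V)

/-- The Hilbert space `L²(ℝ³; ℂ³)`. -/
abbrev L2Space : Type := Lp C3 2 (volume : Measure R3)

/-! ### Extension by zero -/

theorem memLp_indicator {V : Set R3} (hV : IsOpen V) (E : L2 V) :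
    MemLp (V.indicator E) 2 (volume : Measure R3) :=
  (memLp_indicator_iff_restrict hV.measurableSet).2 (Lp.memLp E)

/-- Extension by zero `L²(V; ℂ³) → L²(ℝ³; ℂ³)`. -/
def extendByZero {V : Set R3} (hV : IsOpen V) : L2 V →L[ℂ] L2Space :=
  LinearMap.mkContinuousOfExistsBound
    { toFun := fun E => (memLp_indicator hV E).toLp (V.indicator E)
      map_add' := by
        intro E F
        rw [← MemLp.toLp_add]
        refine MemLp.toLp_congr _ _ ?_
        rw [← Set.indicator_add']
        exact (ae_eq_restrict_iff_indicator_ae_eq hV.measurableSet).1 (Lp.coeFn_add E F)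
      map_smul' := by
        intro c E
        rw [RingHom.id_apply, ← MemLp.toLp_const_smul]
        refine MemLp.toLp_congr _ _ ?_
        have h : c • V.indicator E = V.indicator (c • (E : R3 → C3)) :=
          (Set.indicator_const_smul V c E).symm
        rw [h]
        exact (ae_eq_restrict_iff_indicator_ae_eq hV.measurableSet).1 (Lp.coeFn_smul c E) }
    ⟨1, by
      intro E
      rw [one_mul, LinearMap.coe_mk, AddHom.coe_mk, Lp.norm_toLp, Lp.norm_def,
        eLpNorm_indicator_eq_eLpNorm_restrict hV.measurableSet]⟩

/-! ### The dipole radiation operator -/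

/-- The symbol `v ↦ -q × (q × v) / |q|²` of the dipole radiation operator. -/
def dipoleSymbol (q : R3) (v : C3) : C3 :=
  WithLp.toLp 2
    (-(((‖q‖ ^ 2 : ℝ) : ℂ)⁻¹ • ((fun i => (q i : ℂ)) ⨯₃ ((fun i => (q i : ℂ)) ⨯₃ WithLp.ofLp v))))

theorem dipoleSymbol_eq (q : R3) (v : C3) :
    dipoleSymbol q v = (((‖q‖ ^ 2 : ℝ) : ℂ)⁻¹ * ((‖q‖ ^ 2 : ℝ) : ℂ)) • v
      - (((‖q‖ ^ 2 : ℝ) : ℂ)⁻¹ * ∑ j, (q j : ℂ) * v j) • WithLp.toLp 2 (fun i => (q i : ℂ)) := by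
  have h : ((‖q‖ ^ 2 : ℝ) : ℂ) = (q 0 : ℂ) ^ 2 + (q 1 : ℂ) ^ 2 + (q 2 : ℂ) ^ 2 := by
    rw [EuclideanSpace.real_norm_sq_eq, Fin.sum_univ_three]
    push_cast
    ring
  rw [dipoleSymbol]
  generalize hc : ((‖q‖ ^ 2 : ℝ) : ℂ)⁻¹ = c
  rw [h]
  ext i
  fin_cases i <;>
    simp [crossProduct, Fin.sum_univ_three] <;> ring

theorem dipoleSymbol_add (q : R3) (v w : C3) :
    dipoleSymbol q (v + w) = dipoleSymbol q v + dipoleSymbol q w := by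
  ext i
  simp [dipoleSymbol]
  ring

theorem dipoleSymbol_smul (q : R3) (c : ℂ) (v : C3) :
    dipoleSymbol q (c • v) = c • dipoleSymbol q v := by
  ext i
  simp [dipoleSymbol]
  ring

theorem norm_dipoleSymbol_le (q : R3) (v : C3) : ‖dipoleSymbol q v‖ ≤ 2 * ‖v‖ := by
  have hq : ‖(WithLp.toLp 2 (fun i => (q i : ℂ)) : C3)‖ = ‖q‖ := by
    simp [EuclideanSpace.norm_eq]
  have hsum : ‖∑ j, (q j : ℂ) * v j‖ ≤ ‖q‖ * ‖v‖ := by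
    have h := norm_inner_le_norm (𝕜 := ℂ) (WithLp.toLp 2 (fun i => (q i : ℂ)) : C3) v
    rw [hq] at h
    refine le_trans (le_of_eq ?_) h
    simp [PiLp.inner_apply, mul_comm]
  by_cases h0 : ‖q‖ = 0
  · rw [dipoleSymbol_eq]
    simp [h0]
  rw [dipoleSymbol_eq]
  have hne : (((‖q‖ ^ 2 : ℝ) : ℂ)) ≠ 0 := by
    exact_mod_cast pow_ne_zero 2 h0
  rw [inv_mul_cancel₀ hne, one_smul]
  refine (norm_sub_le _ _).trans ?_
  rw [norm_smul, hq, norm_mul, norm_inv, Complex.norm_real, Real.norm_of_nonneg (by positivity)]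
  have : (‖q‖ ^ 2)⁻¹ * ‖∑ j, (q j : ℂ) * v j‖ * ‖q‖ ≤ ‖v‖ := by
    calc (‖q‖ ^ 2)⁻¹ * ‖∑ j, (q j : ℂ) * v j‖ * ‖q‖
        ≤ (‖q‖ ^ 2)⁻¹ * (‖q‖ * ‖v‖) * ‖q‖ := by gcongr
      _ = ‖v‖ := by field_simp
  linarith

theorem measurable_dipoleSymbol : Measurable (fun p : R3 × C3 => dipoleSymbol p.1 p.2) := by
  have h : (fun p : R3 × C3 => dipoleSymbol p.1 p.2) = fun p : R3 × C3 =>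
      (((‖p.1‖ ^ 2 : ℝ) : ℂ)⁻¹ * ((‖p.1‖ ^ 2 : ℝ) : ℂ)) • p.2
      - (((‖p.1‖ ^ 2 : ℝ) : ℂ)⁻¹ * ∑ j, (p.1 j : ℂ) * p.2 j) •
        (WithLp.toLp 2 (fun i => (p.1 i : ℂ)) : C3) :=
    funext fun p => dipoleSymbol_eq _ _
  rw [h]
  have h1 : Measurable fun p : R3 × C3 => (((‖p.1‖ ^ 2 : ℝ) : ℂ)) := by fun_prop
  have h2 : Measurable fun p : R3 × C3 => (WithLp.toLp 2 (fun i => (p.1 i : ℂ)) : C3) := by fun_prop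
  have h3 : Measurable fun p : R3 × C3 => ∑ j, (p.1 j : ℂ) * p.2 j := by fun_prop
  exact ((h1.inv.mul h1).smul measurable_snd).sub ((h1.inv.mul h3).smul h2)

theorem memLp_dipoleSymbol (F : L2Space) :
    MemLp (fun q => dipoleSymbol q (F q)) 2 (volume : Measure R3) := by
  refine MemLp.of_le_mul (c := 2) (Lp.memLp F) ?_ (ae_of_all _ fun q => norm_dipoleSymbol_le q _)
  exact (measurable_dipoleSymbol.comp
    (measurable_id.prodMk (Lp.stronglyMeasurable F).measurable)).aestronglyMeasurable

/-- Multiplication by the symbol of the dipole radiation operator, on `L²(ℝ³; ℂ³)`. -/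
def dipoleMultiplier : L2Space →L[ℂ] L2Space :=
  LinearMap.mkContinuousOfExistsBound
    { toFun := fun F => (memLp_dipoleSymbol F).toLp (fun q => dipoleSymbol q (F q))
      map_add' := by
        intro F G
        rw [← MemLp.toLp_add]
        refine MemLp.toLp_congr _ _ ?_
        filter_upwards [Lp.coeFn_add F G] with q hq
        rw [hq, Pi.add_apply, dipoleSymbol_add, Pi.add_apply]
      map_smul' := by
        intro c F
        rw [RingHom.id_apply, ← MemLp.toLp_const_smul]
        refine MemLp.toLp_congr _ _ ?_
        filter_upwards [Lp.coeFn_smul c F] with q hq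
        rw [hq, Pi.smul_apply, dipoleSymbol_smul, Pi.smul_apply] }
    ⟨2, by
      intro F
      refine Lp.norm_le_mul_norm_of_ae_le_mul ?_
      filter_upwards [MemLp.coeFn_toLp (memLp_dipoleSymbol F)] with q hq
      rw [LinearMap.coe_mk, AddHom.coe_mk, hq]
      exact norm_dipoleSymbol_le q _⟩

/-- The dipole radiation operator `𝒟 : L²(V; ℂ³) → L²(ℝ³; ℂ³)`: extend by zero, take the
Fourier–Plancherel transform, multiply by the symbol, transform back. With `Ẽ(q) = ∫ E e^{iq·r}`
the definition reads `(𝒟E)(r) = -(2π)⁻³ ∫ q × (q × Ẽ(q)) / |q|² e^{-iq·r} dq`; Mathlib's transform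
is taken at the frequency `w` with `q = -2πw`, and the symbol has the same value at `q` and `w`. -/
def dipoleOp {V : Set R3} (hV : IsOpen V) : L2 V →L[ℂ] L2Space :=
  ((Lp.fourierTransformₗᵢ R3 C3).symm.toContinuousLinearEquiv : L2Space →L[ℂ] L2Space) ∘L
    dipoleMultiplier ∘L
    ((Lp.fourierTransformₗᵢ R3 C3).toContinuousLinearEquiv : L2Space →L[ℂ] L2Space) ∘L
    extendByZero hV

/-- Restriction of fields, `L²(ℝ³; ℂ³) → L²(V; ℂ³)`. -/
def restrictTo (V : Set R3) : L2Space →L[ℂ] L2 V := LpToLpRestrictCLM R3 C3 ℂ volume 2 V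

/-! ### The operator with kernel `Γ` -/

/-- The `i`-th classical partial derivative of a function on `ℝ³`. -/
def partialDeriv (i : Fin 3) (f : R3 → ℂ) (r : R3) : ℂ :=
  fderiv ℝ f r (EuclideanSpace.single i 1)

/-- The function `(e^{-ik|r|} - 1) / (4π|r|)`. -/
def greenDiff (k : ℝ) (r : R3) : ℂ :=
  (Complex.exp (-Complex.I * k * ‖r‖) - 1) / (4 * Real.pi * ‖r‖)

/-- The matrix kernel `Γ(r) = k² e^{-ik|r|} / (4π|r|) 𝟙 + ∇∇ [(e^{-ik|r|} - 1) / (4π|r|)]`; the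
kernel in two variables is `Γ(r - r')`. -/
def kernelMatrix (k : ℝ) (r : R3) : Matrix (Fin 3) (Fin 3) ℂ :=
  ((k : ℂ) ^ 2 * Complex.exp (-Complex.I * k * ‖r‖) / (4 * Real.pi * ‖r‖)) •
      (1 : Matrix (Fin 3) (Fin 3) ℂ) +
    Matrix.of fun i j => partialDeriv i (partialDeriv j (greenDiff k)) r

/-- The field `r ↦ ∫_V Γ(r - r') E(r') dr'`. -/
def gammaField (k : ℝ) (V : Set R3) (E : R3 → C3) (r : R3) : C3 :=
  ∫ s in V, WithLp.toLp 2 (kernelMatrix k (r - s) *ᵥ WithLp.ofLp (E s))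

/-- `h'(t)/t` for `h(t) = (e^{-ikt} - 1) / (4πt)`. -/
def auxP (k t : ℝ) : ℂ :=
  (1 - Complex.exp (-Complex.I * k * t) * (1 + Complex.I * k * t)) / (4 * Real.pi * t ^ 3)

theorem hasDerivAt_exp (k t : ℝ) :
    HasDerivAt (fun t : ℝ => Complex.exp (-Complex.I * k * t))
      (Complex.exp (-Complex.I * k * t) * (-Complex.I * k)) t := by
  have h : HasDerivAt (fun t : ℝ => -Complex.I * k * (t : ℂ)) (-Complex.I * k * 1) t :=
    (Complex.ofRealCLM.hasDerivAt (x := t)).const_mul (-Complex.I * k)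
  rw [mul_one] at h
  exact h.cexp

theorem hasDerivAt_h (k : ℝ) {t : ℝ} (ht : t ≠ 0) :
    HasDerivAt (fun t : ℝ => (Complex.exp (-Complex.I * k * t) - 1) / (4 * Real.pi * t))
      (t * auxP k t) t := by
  have htc : (t : ℂ) ≠ 0 := by exact_mod_cast ht
  have hpi : (Real.pi : ℂ) ≠ 0 := by exact_mod_cast Real.pi_ne_zero
  have h1 := (hasDerivAt_exp k t).sub_const 1
  have h2 : HasDerivAt (fun t : ℝ => 4 * (Real.pi : ℂ) * (t : ℂ)) (4 * Real.pi * 1) t :=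
    (Complex.ofRealCLM.hasDerivAt (x := t)).const_mul (4 * (Real.pi : ℂ))
  have h3 := h1.div h2 (by simp [ht, Real.pi_ne_zero])
  refine h3.congr_deriv ?_
  rw [auxP]
  field_simp
  ring

theorem hasDerivAt_auxP (k : ℝ) {t : ℝ} (ht : t ≠ 0) :
    HasDerivAt (auxP k)
      (-((k : ℂ) ^ 2 * Complex.exp (-Complex.I * k * t) / (4 * Real.pi * t ^ 2))
        - 3 * auxP k t / t) t := by
  have htc : (t : ℂ) ≠ 0 := by exact_mod_cast ht
  have hpi : (Real.pi : ℂ) ≠ 0 := by exact_mod_cast Real.pi_ne_zero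
  have h0 : HasDerivAt (fun t : ℝ => (t : ℂ)) 1 t := Complex.ofRealCLM.hasDerivAt (x := t)
  have h1 := ((hasDerivAt_exp k t).mul ((h0.const_mul (Complex.I * k)).const_add 1)).const_sub 1
  have h2 := (h0.pow 3).const_mul (4 * (Real.pi : ℂ))
  have h3 := h1.div h2 (by simp [ht, Real.pi_ne_zero])
  refine h3.congr_deriv ?_
  simp only [auxP, Pi.mul_apply, Pi.pow_apply]
  field_simp
  ring_nf
  simp only [Complex.I_sq]
  ring

theorem norm_auxP_le (k : ℝ) {t : ℝ} (ht : 0 < t) : ‖auxP k t‖ ≤ k ^ 2 / t := by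
  have key : ∀ x : ℝ, ‖1 - Complex.exp (-Complex.I * x) * (1 + Complex.I * x)‖ ≤ 3 * x ^ 2 := by
    intro x
    have he : ‖Complex.exp (-Complex.I * x)‖ = 1 := by
      rw [Complex.norm_exp]; simp
    have h1 : 1 - Complex.exp (-Complex.I * x) * (1 + Complex.I * x)
        = Complex.exp (-Complex.I * x) * (Complex.exp (Complex.I * x) - 1 - Complex.I * x) := by
      have : Complex.exp (-Complex.I * x) * Complex.exp (Complex.I * x) = 1 := by
        rw [← Complex.exp_add]; simp
      linear_combination -this
    have hn : ‖Complex.I * (x : ℂ)‖ = |x| := by simp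
    rcases le_total |x| 1 with hx | hx
    · rw [h1, norm_mul, he, one_mul]
      refine (Complex.norm_exp_sub_one_sub_id_le (by rwa [hn])).trans ?_
      rw [hn, sq_abs]
      nlinarith [sq_nonneg x]
    · calc ‖1 - Complex.exp (-Complex.I * x) * (1 + Complex.I * x)‖
          ≤ ‖(1 : ℂ)‖ + ‖Complex.exp (-Complex.I * x) * (1 + Complex.I * x)‖ := norm_sub_le _ _
        _ ≤ 1 + (1 + |x|) := by
            rw [norm_mul, he, one_mul, norm_one]
            gcongr
            refine (norm_add_le _ _).trans ?_
            rw [hn, norm_one]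
        _ ≤ 3 * x ^ 2 := by
            rw [← sq_abs]
            nlinarith
  have h := key (k * t)
  have hc : Complex.exp (-Complex.I * ((k * t : ℝ) : ℂ)) * (1 + Complex.I * ((k * t : ℝ) : ℂ))
      = Complex.exp (-Complex.I * k * t) * (1 + Complex.I * k * t) := by
    push_cast
    rw [← mul_assoc, ← mul_assoc]
  rw [hc] at h
  have hd : ‖(4 * Real.pi * t ^ 3 : ℂ)‖ = 4 * Real.pi * t ^ 3 := by
    rw [show (4 * Real.pi * t ^ 3 : ℂ) = ((4 * Real.pi * t ^ 3 : ℝ) : ℂ) by push_cast; ring,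
      Complex.norm_real, Real.norm_of_nonneg (by positivity)]
  rw [auxP, norm_div, hd, div_le_div_iff₀ (by positivity) ht]
  have hpi := Real.pi_gt_three
  calc _ ≤ 3 * (k * t) ^ 2 * t := by gcongr
    _ = 3 * (k ^ 2 * t ^ 3) := by ring
    _ ≤ 4 * Real.pi * (k ^ 2 * t ^ 3) := by gcongr; linarith
    _ = _ := by ring

theorem hasFDerivAt_norm {r : R3} (hr : r ≠ 0) :
    HasFDerivAt (fun x : R3 => ‖x‖) (‖r‖⁻¹ • innerSL ℝ r) r := by
  have h := (hasStrictFDerivAt_norm_sq r).hasFDerivAt.sqrt (pow_ne_zero 2 (norm_ne_zero_iff.2 hr))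
  have h2 : (fun x : R3 => √(‖x‖ ^ 2)) = fun x => ‖x‖ :=
    funext fun x => Real.sqrt_sq (norm_nonneg x)
  rw [h2, Real.sqrt_sq (norm_nonneg r)] at h
  refine h.congr_fderiv ?_
  ext x
  simp
  ring

theorem hasFDerivAt_radial {f : ℝ → ℂ} {f' : ℂ} {r : R3} (hr : r ≠ 0)
    (hf : HasDerivAt f f' ‖r‖) :
    HasFDerivAt (fun x : R3 => f ‖x‖) ((‖r‖⁻¹ • innerSL ℝ r).smulRight f') r :=
  (hf.hasFDerivAt.comp r (hasFDerivAt_norm hr)).congr_fderiv (by ext x; simp [mul_assoc])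

theorem partialDeriv_greenDiff (k : ℝ) (j : Fin 3) {r : R3} (hr : r ≠ 0) :
    partialDeriv j (greenDiff k) r = auxP k ‖r‖ * r j := by
  have hr' : ‖r‖ ≠ 0 := norm_ne_zero_iff.2 hr
  have hrc : (‖r‖ : ℂ) ≠ 0 := by exact_mod_cast hr'
  have h : HasFDerivAt (greenDiff k) _ r := hasFDerivAt_radial hr (hasDerivAt_h k hr')
  rw [partialDeriv, h.fderiv]
  simp [EuclideanSpace.inner_single_right]
  field_simp

theorem hessian_greenDiff (k : ℝ) (i j : Fin 3) {r : R3} (hr : r ≠ 0) :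
    partialDeriv i (partialDeriv j (greenDiff k)) r =
      auxP k ‖r‖ * (if i = j then 1 else 0) +
        (-((k : ℂ) ^ 2 * Complex.exp (-Complex.I * k * ‖r‖) / (4 * Real.pi * ‖r‖ ^ 2))
        - 3 * auxP k ‖r‖ / ‖r‖) * (r i * r j / ‖r‖) := by
  have hr' : ‖r‖ ≠ 0 := norm_ne_zero_iff.2 hr
  have hrc : (‖r‖ : ℂ) ≠ 0 := by exact_mod_cast hr'
  have hev : partialDeriv j (greenDiff k) =ᶠ[nhds r] fun x => auxP k ‖x‖ * x j := by
    filter_upwards [isOpen_ne.mem_nhds hr] with x hx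
    exact partialDeriv_greenDiff k j hx
  have h1 := hasFDerivAt_radial hr (hasDerivAt_auxP k hr')
  have h2 : HasFDerivAt (fun x : R3 => ((x j : ℝ) : ℂ))
      (Complex.ofRealCLM ∘L (EuclideanSpace.proj j : R3 →L[ℝ] ℝ)) r :=
    (Complex.ofRealCLM ∘L (EuclideanSpace.proj j : R3 →L[ℝ] ℝ)).hasFDerivAt
  have h3 : HasFDerivAt (fun x : R3 => auxP k ‖x‖ * ((x j : ℝ) : ℂ)) _ r := h1.mul h2
  rw [partialDeriv, hev.fderiv_eq, h3.fderiv]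
  simp [EuclideanSpace.inner_single_right, eq_comm]
  split_ifs <;> (push_cast; field_simp; try ring)

theorem norm_kernelMatrix_le (k : ℝ) (i j : Fin 3) {r : R3} (hr : r ≠ 0) :
    ‖kernelMatrix k r i j‖ ≤ 6 * k ^ 2 / ‖r‖ := by
  have hr' : 0 < ‖r‖ := norm_pos_iff.2 hr
  have hpi := Real.pi_gt_three
  have he : ‖Complex.exp (-Complex.I * k * ‖r‖)‖ = 1 := by
    rw [Complex.norm_exp]; simp
  have hP := norm_auxP_le k hr'
  have hi : ∀ i, ‖(r i : ℂ)‖ ≤ ‖r‖ := fun i => by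
    rw [Complex.norm_real]; exact PiLp.norm_apply_le r i
  have hdelta : ‖(if i = j then (1 : ℂ) else 0)‖ ≤ 1 := by split_ifs <;> simp
  have hone : ‖(1 : Matrix (Fin 3) (Fin 3) ℂ) i j‖ ≤ 1 := by
    rw [Matrix.one_apply]; exact hdelta
  have hA : ‖(k : ℂ) ^ 2 * Complex.exp (-Complex.I * k * ‖r‖) / (4 * Real.pi * ‖r‖)‖
      ≤ k ^ 2 / ‖r‖ := by
    rw [norm_div, norm_mul, he, mul_one, norm_mul, norm_mul, norm_pow]
    simp only [Complex.norm_real, Real.norm_eq_abs, sq_abs, Complex.norm_ofNat, abs_norm]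
    rw [abs_of_pos Real.pi_pos]
    gcongr
    nlinarith
  have hB : ‖-((k : ℂ) ^ 2 * Complex.exp (-Complex.I * k * ‖r‖) / (4 * Real.pi * ‖r‖ ^ 2))
        - 3 * auxP k ‖r‖ / ‖r‖‖ ≤ 4 * k ^ 2 / ‖r‖ ^ 2 := by
    have e1 : (k : ℂ) ^ 2 * Complex.exp (-Complex.I * k * ‖r‖) / (4 * Real.pi * ‖r‖ ^ 2) =
        (k : ℂ) ^ 2 * Complex.exp (-Complex.I * k * ‖r‖) / (4 * Real.pi * ‖r‖) / ‖r‖ := by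
      rw [div_div]; ring_nf
    refine (norm_sub_le _ _).trans ?_
    rw [norm_neg, e1, norm_div _ (‖r‖ : ℂ), norm_div (3 * _), norm_mul 3]
    simp only [Complex.norm_real, norm_norm, Complex.norm_ofNat]
    calc _ ≤ k ^ 2 / ‖r‖ / ‖r‖ + 3 * (k ^ 2 / ‖r‖) / ‖r‖ := by gcongr
      _ = _ := by field_simp; ring
  have hC : ‖(r i * r j / ‖r‖ : ℂ)‖ ≤ ‖r‖ := by
    rw [norm_div, norm_mul, Complex.norm_real ‖r‖, norm_norm, div_le_iff₀ hr']
    gcongr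
    · exact hi i
    · exact hi j
  rw [kernelMatrix, Matrix.add_apply, Matrix.smul_apply, Matrix.of_apply, smul_eq_mul,
    hessian_greenDiff k i j hr]
  calc _ ≤ ‖(k : ℂ) ^ 2 * Complex.exp (-Complex.I * k * ‖r‖) / (4 * Real.pi * ‖r‖)‖ *
          ‖(1 : Matrix (Fin 3) (Fin 3) ℂ) i j‖ +
        (‖auxP k ‖r‖‖ * ‖(if i = j then (1 : ℂ) else 0)‖ +
        ‖-((k : ℂ) ^ 2 * Complex.exp (-Complex.I * k * ‖r‖) / (4 * Real.pi * ‖r‖ ^ 2))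
        - 3 * auxP k ‖r‖ / ‖r‖‖ * ‖(r i * r j / ‖r‖ : ℂ)‖) := by
        refine (norm_add_le _ _).trans ?_
        rw [norm_mul]
        gcongr
        refine (norm_add_le _ _).trans ?_
        rw [norm_mul, norm_mul]
    _ ≤ k ^ 2 / ‖r‖ * 1 + (k ^ 2 / ‖r‖ * 1 + 4 * k ^ 2 / ‖r‖ ^ 2 * ‖r‖) := by gcongr
    _ = _ := by field_simp; ring

theorem norm_kernelMatrix_mulVec_le (k : ℝ) {r : R3} (hr : r ≠ 0) (v : C3) :
    ‖(WithLp.toLp 2 (kernelMatrix k r *ᵥ WithLp.ofLp v) : C3)‖ ≤ 54 * k ^ 2 / ‖r‖ * ‖v‖ := by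
  have hc : ∀ i, ‖(kernelMatrix k r *ᵥ WithLp.ofLp v) i‖ ≤ 18 * k ^ 2 / ‖r‖ * ‖v‖ := by
    intro i
    rw [Matrix.mulVec, dotProduct]
    refine (norm_sum_le _ _).trans ?_
    calc _ ≤ ∑ _j : Fin 3, 6 * k ^ 2 / ‖r‖ * ‖v‖ := by
          refine Finset.sum_le_sum fun j _ => ?_
          rw [norm_mul]
          gcongr
          · exact norm_kernelMatrix_le k i j hr
          · exact PiLp.norm_apply_le v j
      _ = _ := by simp; ring
  have hnn : (0 : ℝ) ≤ 18 * k ^ 2 / ‖r‖ * ‖v‖ := by positivity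
  rw [EuclideanSpace.norm_eq]
  refine Real.sqrt_le_iff.2 ⟨by positivity, ?_⟩
  calc _ ≤ ∑ _i : Fin 3, (18 * k ^ 2 / ‖r‖ * ‖v‖) ^ 2 :=
        Finset.sum_le_sum fun i _ => by gcongr; exact hc i
    _ = 3 * (18 * k ^ 2 / ‖r‖ * ‖v‖) ^ 2 := by simp
    _ ≤ 9 * (18 * k ^ 2 / ‖r‖ * ‖v‖) ^ 2 := by gcongr; norm_num
    _ = _ := by ring

theorem measurable_kernelMatrix (k : ℝ) (i j : Fin 3) :
    Measurable fun r => kernelMatrix k r i j := by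
  simp only [kernelMatrix, Matrix.add_apply, Matrix.smul_apply, Matrix.of_apply, smul_eq_mul]
  refine Measurable.add (Measurable.mul_const ?_ _) (measurable_fderiv_apply_const ℝ _ _)
  fun_prop

theorem measurable_integrand (k : ℝ) {V : Set R3} (E : L2 V) :
    Measurable (fun p : R3 × R3 =>
      (WithLp.toLp 2 (kernelMatrix k (p.1 - p.2) *ᵥ WithLp.ofLp (E p.2)) : C3)) := by
  have hE : Measurable (E : R3 → C3) := (Lp.stronglyMeasurable E).measurable
  refine (WithLp.measurable_toLp 2 (Fin 3 → ℂ)).comp (measurable_pi_lambda _ fun i => ?_)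
  simp only [Matrix.mulVec, dotProduct]
  refine Finset.measurable_sum _ fun j _ => Measurable.mul ?_ ?_
  · exact (measurable_kernelMatrix k i j).comp (measurable_fst.sub measurable_snd)
  · have hj : Measurable fun v : C3 => v j := by fun_prop
    exact hj.comp (hE.comp measurable_snd)

theorem exists_lintegral_le (k : ℝ) {V : Set R3} (hb : Bornology.IsBounded V) :
    ∃ M : NNReal, ∀ r ∈ V, ∀ E : L2 V,
      ∫⁻ s in V, ‖(WithLp.toLp 2 (kernelMatrix k (r - s) *ᵥ WithLp.ofLp (E s)) : C3)‖ₑ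
        ≤ M * ‖E‖ₑ := by
  obtain ⟨R, hR⟩ := hb.subset_ball 0
  set K : R3 → ENNReal := fun x => ENNReal.ofReal (54 * k ^ 2 / ‖x‖) with hK
  have hKm : Measurable K := by fun_prop
  have hfin : ∫⁻ x in Metric.ball (0 : R3) (2 * R), K x ^ (2 : ℝ) < ⊤ := by
    have hloc : LocallyIntegrable (fun x : R3 => (54 * k ^ 2 / ‖x‖) ^ 2) volume := by
      refine locallyIntegrable_of_norm_le_rpow (C := (54 * k ^ 2) ^ 2) (α := 2) (by simp)
        (by simp; norm_num) (ae_of_all _ fun x => ?_)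
        ((measurable_const.div measurable_norm).pow_const 2).aestronglyMeasurable
      rw [Real.norm_of_nonneg (by positivity), Real.rpow_neg (norm_nonneg x), div_pow,
        Real.rpow_two, div_eq_mul_inv]
    have hint : IntegrableOn (fun x : R3 => (54 * k ^ 2 / ‖x‖) ^ 2)
        (Metric.ball (0 : R3) (2 * R)) volume :=
      (hloc.integrableOn_isCompact (isCompact_closedBall (0 : R3) (2 * R))).mono_set
        Metric.ball_subset_closedBall
    have h := hint.2
    rw [hasFiniteIntegral_iff_ofReal (ae_of_all _ fun x => by positivity)] at h
    refine lt_of_le_of_lt (le_of_eq (lintegral_congr fun x => ?_)) h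
    rw [hK, ENNReal.rpow_two, ENNReal.ofReal_pow (by positivity)]
  refine ⟨((∫⁻ x in Metric.ball (0 : R3) (2 * R), K x ^ (2 : ℝ)) ^ (1 / (2 : ℝ))).toNNReal,
    fun r hr E => ?_⟩
  rw [ENNReal.coe_toNNReal (ENNReal.rpow_lt_top_of_nonneg (by norm_num) hfin.ne).ne]
  have hE : ‖E‖ₑ = (∫⁻ s in V, ‖E s‖ₑ ^ (2 : ℝ)) ^ (1 / (2 : ℝ)) := by
    rw [Lp.enorm_def, eLpNorm_eq_lintegral_rpow_enorm_toReal (by norm_num) (by norm_num)]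
    simp
  have hle : ∫⁻ s in V, K (r - s) ^ (2 : ℝ) ≤
      ∫⁻ x in Metric.ball (0 : R3) (2 * R), K x ^ (2 : ℝ) := by
    have hsub : V ⊆ (fun s => r - s) ⁻¹' Metric.ball (0 : R3) (2 * R) := by
      intro s hs
      have h1 := mem_ball_zero_iff.1 (hR hr)
      have h2 := mem_ball_zero_iff.1 (hR hs)
      rw [Set.mem_preimage, mem_ball_zero_iff]
      linarith [norm_sub_le r s]
    have hmeas : MeasurableSet ((fun s => r - s) ⁻¹' Metric.ball (0 : R3) (2 * R)) :=
      (measurable_const.sub measurable_id) Metric.isOpen_ball.measurableSet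
    calc ∫⁻ s in V, K (r - s) ^ (2 : ℝ)
        ≤ ∫⁻ s in (fun s => r - s) ⁻¹' Metric.ball (0 : R3) (2 * R), K (r - s) ^ (2 : ℝ) :=
          lintegral_mono_set hsub
      _ = ∫⁻ s, (Metric.ball (0 : R3) (2 * R)).indicator (fun x => K x ^ (2 : ℝ)) (r - s) := by
          rw [← lintegral_indicator hmeas]
          rfl
      _ = ∫⁻ x in Metric.ball (0 : R3) (2 * R), K x ^ (2 : ℝ) := by
          rw [lintegral_sub_left_eq_self
              ((Metric.ball (0 : R3) (2 * R)).indicator fun x => K x ^ (2 : ℝ)) r,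
            lintegral_indicator Metric.isOpen_ball.measurableSet]
  calc ∫⁻ s in V, ‖(WithLp.toLp 2 (kernelMatrix k (r - s) *ᵥ WithLp.ofLp (E s)) : C3)‖ₑ
      ≤ ∫⁻ s in V, ((fun s => K (r - s)) * fun s => ‖E s‖ₑ) s := by
        refine lintegral_mono_ae (ae_restrict_of_ae ?_)
        filter_upwards [Measure.ae_ne volume r] with s hs
        rw [Pi.mul_apply, hK, ← ofReal_norm, ← ofReal_norm,
          ← ENNReal.ofReal_mul (by positivity)]
        exact ENNReal.ofReal_le_ofReal
          (norm_kernelMatrix_mulVec_le k (sub_ne_zero.2 hs.symm) (E s))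
    _ ≤ (∫⁻ s in V, K (r - s) ^ (2 : ℝ)) ^ (1 / (2 : ℝ)) *
          (∫⁻ s in V, ‖E s‖ₑ ^ (2 : ℝ)) ^ (1 / (2 : ℝ)) := by
        refine ENNReal.lintegral_mul_le_Lp_mul_Lq _ Real.HolderConjugate.two_two ?_ ?_
        · exact (hKm.comp (measurable_const.sub measurable_id)).aemeasurable
        · exact (Lp.stronglyMeasurable E).measurable.enorm.aemeasurable
    _ ≤ _ := by
        rw [hE]
        gcongr

theorem integrable_integrand (k : ℝ) {V : Set R3} (hb : Bornology.IsBounded V) (E : L2 V)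
    {r : R3} (hr : r ∈ V) :
    Integrable (fun s => (WithLp.toLp 2 (kernelMatrix k (r - s) *ᵥ WithLp.ofLp (E s)) : C3))
      (volume.restrict V) := by
  obtain ⟨M, hM⟩ := exists_lintegral_le k hb
  refine ⟨((measurable_integrand k E).comp measurable_prodMk_left).aestronglyMeasurable, ?_⟩
  exact (hM r hr E).trans_lt (ENNReal.mul_lt_top ENNReal.coe_lt_top enorm_lt_top)

theorem exists_norm_gammaField_le (k : ℝ) {V : Set R3} (hb : Bornology.IsBounded V) :
    ∃ M : NNReal, ∀ E : L2 V, ∀ r ∈ V, ‖gammaField k V E r‖ ≤ M * ‖E‖ := by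
  obtain ⟨M, hM⟩ := exists_lintegral_le k hb
  refine ⟨M, fun E r hr => ?_⟩
  have h := (enorm_integral_le_lintegral_enorm _).trans (hM r hr E)
  rw [← ofReal_norm, ← ofReal_norm, ← ENNReal.ofReal_coe_nnreal,
    ← ENNReal.ofReal_mul (by positivity)] at h
  exact (ENNReal.ofReal_le_ofReal_iff (by positivity)).1 h

theorem memLp_gammaField (k : ℝ) {V : Set R3} (hV : IsOpen V) (hb : Bornology.IsBounded V)
    (E : L2 V) : MemLp (gammaField k V E) 2 (volume.restrict V) := by
  obtain ⟨M, hM⟩ := exists_norm_gammaField_le k hb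
  have : IsFiniteMeasure ((volume : Measure R3).restrict V) :=
    isFiniteMeasure_restrict.2 hb.measure_lt_top.ne
  refine MemLp.of_bound ?_ (M * ‖E‖) ((ae_restrict_iff' hV.measurableSet).2
    (ae_of_all _ fun r hr => hM E r hr))
  exact ((measurable_integrand k E).stronglyMeasurable.integral_prod_right
    (ν := (volume : Measure R3).restrict V)).aestronglyMeasurable

/-- The integral operator `γ : L²(V; ℂ³) → L²(V; ℂ³)`, `(γE)(r) = ∫_V Γ(r - r') E(r') dr'`, for a
bounded open set `V`. -/
def gammaOp (k : ℝ) {V : Set R3} (hV : IsOpen V) (hb : Bornology.IsBounded V) :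
    L2 V →L[ℂ] L2 V :=
  LinearMap.mkContinuousOfExistsBound
    { toFun := fun E => (memLp_gammaField k hV hb E).toLp (gammaField k V E)
      map_add' := by
        intro E F
        rw [← MemLp.toLp_add]
        refine MemLp.toLp_congr _ _ ((ae_restrict_iff' hV.measurableSet).2
          (ae_of_all _ fun r hr => ?_))
        rw [Pi.add_apply, gammaField, gammaField, gammaField,
          ← integral_add (integrable_integrand k hb E hr) (integrable_integrand k hb F hr)]
        refine integral_congr_ae ?_
        filter_upwards [Lp.coeFn_add E F] with s hs
        rw [hs, Pi.add_apply, WithLp.ofLp_add, Matrix.mulVec_add, WithLp.toLp_add]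
      map_smul' := by
        intro c E
        rw [RingHom.id_apply, ← MemLp.toLp_const_smul]
        refine MemLp.toLp_congr _ _ (ae_of_all _ fun r => ?_)
        rw [Pi.smul_apply, gammaField, gammaField, ← integral_smul]
        refine integral_congr_ae ?_
        filter_upwards [Lp.coeFn_smul c E] with s hs
        rw [hs, Pi.smul_apply, WithLp.ofLp_smul, Matrix.mulVec_smul, WithLp.toLp_smul] }
    (by
      obtain ⟨M, hM⟩ := exists_norm_gammaField_le k hb
      have : IsFiniteMeasure ((volume : Measure R3).restrict V) :=
        isFiniteMeasure_restrict.2 hb.measure_lt_top.ne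
      refine ⟨(measureUnivNNReal ((volume : Measure R3).restrict V) : ℝ) ^ (1 / 2 : ℝ) * M, fun E => ?_⟩
      rw [mul_assoc]
      refine (Lp.norm_le_of_ae_bound (by positivity) ((?_ : ∀ᵐ r ∂volume.restrict V,
        ‖(memLp_gammaField k hV hb E).toLp (gammaField k V E) r‖ ≤ M * ‖E‖))).trans
          (le_of_eq ?_)
      · filter_upwards [(memLp_gammaField k hV hb E).coeFn_toLp,
          ae_restrict_mem hV.measurableSet] with r hr hrV
        rw [hr]
        exact hM E r hrV
      · simp)

/-! ### The Born operator and the Fredholm index -/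

/-- The Born operator `(1 + χ) I - χ 𝒟 - χ γ` on `L²(V; ℂ³)`, with wave number `k` and
susceptibility `χ`. -/
def bornOp (k : ℝ) (χ : ℂ) {V : Set R3} (hV : IsOpen V) (hb : Bornology.IsBounded V) :
    L2 V →L[ℂ] L2 V :=
  (1 + χ) • ContinuousLinearMap.id ℂ (L2 V) - χ • (restrictTo V ∘L dipoleOp hV) -
    χ • gammaOp k hV hb

/-- The index `dim ker u - dim (ran u)^⊥` of a (Fredholm) operator on a Hilbert space. -/
def fredholmIndex {H : Type*} [NormedAddCommGroup H] [InnerProductSpace ℂ H]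
    (u : H →L[ℂ] H) : ℤ :=
  (Module.finrank ℂ u.ker : ℤ) - (Module.finrank ℂ u.rangeᗮ : ℤ)

end BornScattering

end

/-! The Born operator splits as `A - χγ` with principal part `A = (1 + χ)I - χ𝒟`, and the claim
follows from two facts: `A` is invertible and `γ` is compact.

Invertibility. In Fourier space `𝒟` is the orthogonal projection of the field onto the plane
transverse to `q`, so its compression to `V` has quadratic form with values `t ∈ [0, ‖E‖²]`. Hence
`⟨E, AE⟩ = ‖E‖² (1 + χs)` with `s = 1 - t/‖E‖² ∈ [0, 1]`. The factor vanishes only if `χ = -1/s ≤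
-1`, which is excluded. By compactness of `[0, 1]` it is bounded away from zero, so `A` is coercive
and therefore a unit (`isUnit_principalPart`).

Compactness. Subtracting the static term leaves a kernel of size `O(1/|r|)`, square integrable near
the origin of `ℝ³`. For bounded `V` this makes `γ` Hilbert–Schmidt (`summable_norm_gammaOp_sq`),
hence a norm limit of operators of finite rank (`exists_finiteRank_norm_sub_le`).

Since units form an open set, moving a finite-rank part `F` of `χγ` aside leaves a unit, and the
Born operator is this unit minus `F`. Such an operator has index zero
(`isFredholm_and_fredholmIndex_eq_zero`), which reduces to rank–nullity on a finite-dimensional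
space. -/

noncomputable section

namespace BornScattering

/-! ### Finite-rank perturbations of invertible operators -/

/-- A finite-rank perturbation of the identity has kernel and cokernel of the same dimension. -/
theorem finrank_ker_eq_finrank_quotient_range {K E : Type*} [Field K] [AddCommGroup E] [Module K E]
    (g : E →ₗ[K] E) (hg : g.HasFiniteRange) :
    Module.finrank K (LinearMap.ker (LinearMap.id + g)) =
      Module.finrank K (E ⧸ LinearMap.range (LinearMap.id + g)) := by
  set T : E →ₗ[K] E := LinearMap.id + g with hT
  have hTx : ∀ x, T x = x + g x := fun x => rfl
  -- Everything reduces to the finite-dimensional space `W`: it is stable under `T`, contains `ker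
  -- T` (there `x = -g x`), and surjects onto the cokernel of `T`. Rank–nullity for `S = T|W` then
  -- concludes.
  set W := LinearMap.range g with hW
  have : FiniteDimensional K W := Module.Finite.of_fg hg
  have hmap : ∀ x ∈ W, T x ∈ W := fun x hx => W.add_mem hx ⟨x, rfl⟩
  set S : W →ₗ[K] W := T.restrict hmap with hS
  have hSx : ∀ x : W, (S x : E) = T x := fun x => rfl
  have hker : LinearMap.ker T ≤ W := fun x hx => by
    rw [LinearMap.mem_ker, hTx] at hx
    exact ⟨-x, by rw [map_neg, ← eq_neg_of_add_eq_zero_left hx]⟩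
  have e1 : Module.finrank K (LinearMap.ker T) = Module.finrank K (LinearMap.ker S) := by
    have h : LinearMap.ker S = (LinearMap.ker T).comap W.subtype := by
      ext x
      rw [LinearMap.mem_ker, Submodule.mem_comap, LinearMap.mem_ker, ← Subtype.coe_inj, hSx]
      rfl
    rw [h]
    exact (Submodule.comapSubtypeEquivOfLe hker).finrank_eq.symm
  set q : W →ₗ[K] E ⧸ LinearMap.range T := (LinearMap.range T).mkQ ∘ₗ W.subtype with hq
  have hqs : Function.Surjective q := by
    intro y
    obtain ⟨x, rfl⟩ := Submodule.mkQ_surjective _ y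
    -- `-g x` and `x` agree modulo the range, as `-g x - x = T (-x)`.
    refine ⟨⟨-g x, W.neg_mem ⟨x, rfl⟩⟩, ?_⟩
    rw [hq, LinearMap.comp_apply, Submodule.mkQ_apply, Submodule.mkQ_apply, Submodule.Quotient.eq]
    refine ⟨-x, ?_⟩
    rw [map_neg, hTx, Submodule.subtype_apply]
    abel_nf
  have hqk : LinearMap.ker q = LinearMap.range S := by
    ext w
    rw [LinearMap.mem_ker, hq, LinearMap.comp_apply, Submodule.mkQ_apply,
      Submodule.Quotient.mk_eq_zero, Submodule.subtype_apply]
    constructor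
    · rintro ⟨x, hx⟩
      have hxW : x ∈ W := by
        have h : x = w - g x := by rw [← hx, hTx]; abel
        rw [h]
        exact W.sub_mem w.2 ⟨x, rfl⟩
      exact ⟨⟨x, hxW⟩, Subtype.ext hx⟩
    · rintro ⟨x, rfl⟩
      exact ⟨x, rfl⟩
  have e2 := (q.quotKerEquivOfSurjective hqs).finrank_eq
  rw [hqk] at e2
  have h1 := LinearMap.finrank_range_add_finrank_ker S
  have h2 := (LinearMap.range S).finrank_quotient_add_finrank
  omega

section Fredholm

variable {H : Type*} [NormedAddCommGroup H] [InnerProductSpace ℂ H]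

/-- A closed subspace of a Hilbert space is complemented by its orthogonal. This lets the index,
defined through `(ran u)ᗮ`, be computed from the algebraic cokernel. -/
theorem finrank_orthogonal_eq_finrank_quotient [CompleteSpace H] (R : Submodule ℂ H)
    (hR : IsClosed (R : Set H)) : Module.finrank ℂ Rᗮ = Module.finrank ℂ (H ⧸ R) := by
  have : CompleteSpace R := hR.completeSpace_coe
  exact (Submodule.quotientEquivOfIsCompl R Rᗮ R.isCompl_orthogonal).finrank_eq.symm

/-- The inverse `b` of `a` inverts `u` modulo finite rank on both sides, which gives the Fredholm
property. Moreover `b ∘ u = id + g` with `g` of finite rank, and composing with the bijection `b`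
changes neither the kernel nor the dimension of the cokernel. -/
theorem isFredholm_and_fredholmIndex_eq_zero [CompleteSpace H] {u a : H →L[ℂ] H} (ha : IsUnit a)
    (hua : ((u - a : H →L[ℂ] H) : H →ₗ[ℂ] H).HasFiniteRange) :
    u.IsFredholm ∧ fredholmIndex u = 0 := by
  obtain ⟨a, rfl⟩ := ha
  set b : H →L[ℂ] H := ((a⁻¹ : (H →L[ℂ] H)ˣ) : H →L[ℂ] H) with hb
  have hab : ∀ x, (a : H →L[ℂ] H) (b x) = x := fun x => DFunLike.congr_fun a.mul_inv x
  have hba : ∀ x, b ((a : H →L[ℂ] H) x) = x := fun x => DFunLike.congr_fun a.inv_mul x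
  have hf : u.IsFredholm := by
    refine ContinuousLinearMap.IsFredholm.of_isQuasiInverse (v := b) ⟨?_, ?_⟩
    · refine LinearMap.FiniteRangeSetoid.equiv_iff_hasFiniteRange.2 ?_
      have h : (b : H →ₗ[ℂ] H) ∘ₗ (u : H →ₗ[ℂ] H) - LinearMap.id =
          (b : H →ₗ[ℂ] H) ∘ₗ ((u - a : H →L[ℂ] H) : H →ₗ[ℂ] H) := by
        ext x
        simp [hba]
      exact h ▸ hua.comp_left _
    · refine LinearMap.FiniteRangeSetoid.equiv_iff_hasFiniteRange.2 ?_
      have h : (u : H →ₗ[ℂ] H) ∘ₗ (b : H →ₗ[ℂ] H) - LinearMap.id =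
          ((u - a : H →L[ℂ] H) : H →ₗ[ℂ] H) ∘ₗ (b : H →ₗ[ℂ] H) := by
        ext x
        simp [hab]
      exact h ▸ hua.comp_right _
  refine ⟨hf, ?_⟩
  set g : H →ₗ[ℂ] H := (b : H →ₗ[ℂ] H) ∘ₗ ((u - a : H →L[ℂ] H) : H →ₗ[ℂ] H) with hg
  have hgf : g.HasFiniteRange := hua.comp_left _
  have hu : ∀ x, b (u x) = (LinearMap.id + g : H →ₗ[ℂ] H) x := fun x => by
    simp [hg, hba]
  have hker : u.ker = LinearMap.ker (LinearMap.id + g) := by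
    ext x
    rw [LinearMap.mem_ker, LinearMap.mem_ker, ← hu]
    constructor
    · intro h
      have h' : u x = 0 := h
      rw [h', map_zero]
    · intro h
      have h' := congrArg (a : H →L[ℂ] H) h
      rwa [hab, map_zero] at h'
  let e : H ≃ₗ[ℂ] H := LinearEquiv.ofLinearMap (b : H →ₗ[ℂ] H) ((a : H →L[ℂ] H) : H →ₗ[ℂ] H)
    (LinearMap.ext hba) (LinearMap.ext hab)
  have hr : u.range.map (e : H →ₗ[ℂ] H) = LinearMap.range (LinearMap.id + g) := by
    rw [← LinearMap.range_comp]
    congr 1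
    exact LinearMap.ext hu
  have e2 := (Submodule.Quotient.equiv _ _ e hr).finrank_eq
  rw [fredholmIndex, finrank_orthogonal_eq_finrank_quotient _ hf.isClosed_range, e2, hker,
    finrank_ker_eq_finrank_quotient_range g hgf, sub_self]

/-! ### Hilbert–Schmidt operators -/

/-- An operator with square-summable values on a Hilbert basis is a limit of operators of finite
rank. -/
theorem exists_finiteRank_norm_sub_le {ι : Type*} (b : HilbertBasis ι ℂ H) (T : H →L[ℂ] H)
    (hs : Summable fun i => ‖T (b i)‖ ^ 2) {ε : ℝ} (hε : 0 < ε) :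
    ∃ F : H →L[ℂ] H, (F : H →ₗ[ℂ] H).HasFiniteRange ∧ ‖T - F‖ ≤ ε := by
  obtain ⟨s, hs'⟩ := summable_iff_vanishing_norm.1 hs (ε ^ 2) (by positivity)
  -- The approximant is `T` after the orthogonal projection onto the span of the `b i`, `i ∈ s`,
  -- where `s` carries all but `ε²` of the sum of squares.
  refine ⟨∑ i ∈ s, (innerSL ℂ (b i)).smulRight (T (b i)), ?_, ?_⟩
  · rw [LinearMap.hasFiniteRange_iff_range]
    have hfg : (Submodule.span ℂ (((fun i => T (b i)) '' (s : Set ι)))).FG :=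
      Submodule.fg_span (s.finite_toSet.image _)
    have : FiniteDimensional ℂ (Submodule.span ℂ (((fun i => T (b i)) '' (s : Set ι)))) :=
      Module.Finite.of_fg hfg
    refine (Submodule.fg_iff_finiteDimensional _).2 (Submodule.finiteDimensional_of_le ?_
      (S₂ := Submodule.span ℂ (((fun i => T (b i)) '' (s : Set ι)))))
    rintro _ ⟨x, rfl⟩
    rw [ContinuousLinearMap.coe_coe, sum_apply]
    exact Submodule.sum_mem _ fun i hi => Submodule.smul_mem _ _
      (Submodule.subset_span ⟨i, hi, rfl⟩)
  · refine ContinuousLinearMap.opNorm_le_bound _ hε.le fun x => ?_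
    have hx : HasSum (fun i => inner ℂ (b i) x • T (b i)) (T x) := by
      have h := (b.hasSum_repr x).mapL T
      simpa [b.repr_apply_apply] using h
    have hlim : Filter.Tendsto (fun t : Finset ι => ‖(∑ i ∈ t, inner ℂ (b i) x • T (b i)) -
        ∑ i ∈ s, inner ℂ (b i) x • T (b i)‖) Filter.atTop
        (nhds ‖(T - ∑ i ∈ s, (innerSL ℂ (b i)).smulRight (T (b i))) x‖) := by
      have h := (Filter.Tendsto.sub_const hx (∑ i ∈ s, inner ℂ (b i) x • T (b i))).norm
      simpa [sum_apply] using h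
    refine le_of_tendsto hlim (Filter.eventually_atTop.2 ⟨s, fun t hst => ?_⟩)
    classical
    rw [← Finset.sum_sdiff hst, add_sub_cancel_right]
    have h1 := hs' (t \ s) Finset.sdiff_disjoint
    rw [Real.norm_of_nonneg (Finset.sum_nonneg fun i _ => by positivity)] at h1
    have h2 := b.orthonormal.sum_inner_products_le x (s := t \ s)
    -- Cauchy–Schwarz on the tail: Bessel bounds the squared coefficients by `‖x‖²`, and the choice
    -- of `s` bounds the squared values by `ε²`.
    refine (norm_sum_le _ _).trans (abs_le_of_sq_le_sq' ?_ (by positivity)).2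
    simp only [norm_smul]
    calc (∑ i ∈ t \ s, ‖inner ℂ (b i) x‖ * ‖T (b i)‖) ^ 2
        ≤ (∑ i ∈ t \ s, ‖inner ℂ (b i) x‖ ^ 2) * ∑ i ∈ t \ s, ‖T (b i)‖ ^ 2 :=
          Finset.sum_mul_sq_le_sq_mul_sq _ _ _
      _ ≤ ‖x‖ ^ 2 * ε ^ 2 := by gcongr
      _ = (ε * ‖x‖) ^ 2 := by ring

/-- Bessel's inequality for the values of a functional on an orthonormal family. -/
theorem sum_norm_sq_apply_le [CompleteSpace H] {ι : Type*} {v : ι → H} (hv : Orthonormal ℂ v)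
    (s : Finset ι) (l : H →L[ℂ] ℂ) : ∑ i ∈ s, ‖l (v i)‖ ^ 2 ≤ ‖l‖ ^ 2 := by
  -- The usual Bessel inequality, applied to the Riesz representative of `l`.
  have h := hv.sum_inner_products_le ((InnerProductSpace.toDual ℂ H).symm l) (s := s)
  rw [LinearIsometryEquiv.norm_map] at h
  refine (Finset.sum_le_sum fun i _ => le_of_eq ?_).trans h
  rw [norm_inner_symm, InnerProductSpace.toDual_symm_apply]

end Fredholm

/-! ### The dipole radiation operator compressed to `V` -/

/-- Extension by zero is adjoint to restriction, so quadratic forms on `V` can be evaluated on all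
of `ℝ³`, where the Fourier transform is available. -/
theorem inner_extendByZero {V : Set R3} (hV : IsOpen V) (E : L2 V) (G : L2Space) :
    inner ℂ (extendByZero hV E) G = inner ℂ E (restrictTo V G) := by
  have h1 : extendByZero hV E =ᵐ[volume] V.indicator E := (memLp_indicator hV E).coeFn_toLp
  have h2 : restrictTo V G =ᵐ[volume.restrict V] G := LpToLpRestrictCLM_coeFn ℂ V G
  rw [L2.inner_def, L2.inner_def, ← integral_indicator hV.measurableSet |>.trans
    (integral_congr_ae (h2.mono fun x hx => by rw [hx]) : ∫ x in V, inner ℂ (E x) (G x) = _)]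
  refine integral_congr_ae (h1.mono fun x hx => ?_)
  simp only [hx]
  by_cases hxV : x ∈ V <;> simp [hxV]

theorem norm_extendByZero {V : Set R3} (hV : IsOpen V) (E : L2 V) :
    ‖extendByZero hV E‖ = ‖E‖ := by
  change ‖(memLp_indicator hV E).toLp (V.indicator E)‖ = _
  rw [Lp.norm_toLp, Lp.norm_def, eLpNorm_indicator_eq_eLpNorm_restrict hV.measurableSet]

/-- The symbol of the dipole radiation operator is a self-adjoint contraction. -/
theorem inner_dipoleSymbol (q : R3) (v : C3) :
    ∃ t : ℝ, inner ℂ v (dipoleSymbol q v) = t ∧ 0 ≤ t ∧ t ≤ ‖v‖ ^ 2 := by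
  have hvv : inner ℂ v v = ((‖v‖ ^ 2 : ℝ) : ℂ) := by
    rw [inner_self_eq_norm_sq_to_K]; simp
  set w : C3 := WithLp.toLp 2 (fun i => (q i : ℂ)) with hw
  have hwn : ‖w‖ = ‖q‖ := by simp [hw, EuclideanSpace.norm_eq]
  have hsum : ∑ j, (q j : ℂ) * v j = inner ℂ w v := by
    simp [hw, PiLp.inner_apply, mul_comm]
  rw [dipoleSymbol_eq, ← hw, hsum]
  by_cases h0 : ‖q‖ = 0
  -- At `q = 0` the convention `0⁻¹ = 0` makes the symbol vanish.
  · exact ⟨0, by simp [h0], le_rfl, by positivity⟩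
  have hne : (((‖q‖ ^ 2 : ℝ) : ℂ)) ≠ 0 := by exact_mod_cast pow_ne_zero 2 h0
  have hcs : ‖inner ℂ w v‖ ≤ ‖q‖ * ‖v‖ := hwn ▸ norm_inner_le_norm w v
  -- The squared norm of the component of `v` orthogonal to `q`; it is nonnegative by
  -- Cauchy–Schwarz.
  refine ⟨‖v‖ ^ 2 - (‖q‖ ^ 2)⁻¹ * ‖inner ℂ w v‖ ^ 2, ?_, ?_, ?_⟩
  · rw [inv_mul_cancel₀ hne, one_smul, inner_sub_right, inner_smul_right, hvv, mul_assoc,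
      ← inner_conj_symm v w, Complex.mul_conj']
    push_cast
    ring
  · rw [sub_nonneg, inv_mul_le_iff₀ (by positivity), ← mul_pow]
    gcongr
  · rw [sub_le_self_iff]
    positivity

theorem norm_sq_eq_integral {μ : Measure R3} (F : Lp C3 2 μ) :
    ‖F‖ ^ 2 = ∫ q, ‖F q‖ ^ 2 ∂μ := by
  have h := L2.inner_def (𝕜 := ℂ) F F
  have h' : ∫ q, inner ℂ (F q) (F q) ∂μ = ((∫ q, ‖F q‖ ^ 2 ∂μ : ℝ) : ℂ) := by
    refine (integral_congr_ae (ae_of_all _ fun q => ?_)).trans integral_complex_ofReal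
    simp [inner_self_eq_norm_sq_to_K]
  rw [inner_self_eq_norm_sq_to_K, h'] at h
  refine Complex.ofReal_injective (Eq.trans ?_ h)
  push_cast
  rfl

theorem inner_dipoleMultiplier (F : L2Space) :
    ∃ t : ℝ, inner ℂ F (dipoleMultiplier F) = t ∧ 0 ≤ t ∧ t ≤ ‖F‖ ^ 2 := by
  choose τ h1 h2 h3 using fun q => inner_dipoleSymbol q (F q)
  have hM : dipoleMultiplier F =ᵐ[volume] fun q => dipoleSymbol q (F q) :=
    (memLp_dipoleSymbol F).coeFn_toLp
  have hτ : (fun q => inner ℂ (F q) (dipoleMultiplier F q)) =ᵐ[volume] fun q => (τ q : ℂ) :=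
    hM.mono fun q hq => by simp only [hq, h1]
  -- `τ` is chosen pointwise, with no measurability; integrability is inherited from the a.e. equal
  -- inner product of two `L²` fields.
  have hi : Integrable (fun q => (τ q : ℂ)) (volume : Measure R3) :=
    (L2.integrable_inner F (dipoleMultiplier F)).congr hτ
  have hi' : Integrable τ (volume : Measure R3) := by
    have := hi.re
    simpa using this
  have hn := norm_sq_eq_integral F
  refine ⟨∫ q, τ q, ?_, integral_nonneg h2, ?_⟩
  · rw [L2.inner_def, integral_congr_ae hτ]
    exact integral_ofReal
  · rw [hn]
    exact integral_mono hi' ((memLp_two_iff_integrable_sq_norm (Lp.memLp F).1).1 (Lp.memLp F)) h3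

/-- By adjointness and Plancherel, the form at `E` is that of the multiplier at the transform of the
extended field, which has the same norm as `E`. -/
theorem inner_restrictTo_dipoleOp {V : Set R3} (hV : IsOpen V) (E : L2 V) :
    ∃ t : ℝ, inner ℂ E (restrictTo V (dipoleOp hV E)) = t ∧ 0 ≤ t ∧ t ≤ ‖E‖ ^ 2 := by
  set Φ := Lp.fourierTransformₗᵢ R3 C3
  obtain ⟨t, h1, h2, h3⟩ := inner_dipoleMultiplier (Φ (extendByZero hV E))
  refine ⟨t, ?_, h2, ?_⟩
  · have hD : dipoleOp hV E = Φ.symm (dipoleMultiplier (Φ (extendByZero hV E))) := rfl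
    rw [← inner_extendByZero hV, hD, ← Φ.inner_map_map, Φ.apply_symm_apply, h1]
  · rwa [Φ.norm_map, norm_extendByZero] at h3

/-- For `χ` off the cut `(-∞, -1]`, the segment from `1` to `1 + χ` stays away from `0`. -/
theorem exists_pos_le_norm_one_add_mul {χ : ℂ} (hχ : ∀ x : ℝ, x ≤ -1 → χ ≠ (x : ℂ)) :
    ∃ c : ℝ, 0 < c ∧ ∀ s ∈ Set.Icc (0 : ℝ) 1, c ≤ ‖1 + χ * s‖ := by
  obtain ⟨s₀, hs₀, hmin⟩ := (isCompact_Icc (a := (0 : ℝ)) (b := 1)).exists_isMinOn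
    ⟨0, by simp⟩ (f := fun s : ℝ => ‖1 + χ * s‖) (by fun_prop)
  refine ⟨‖1 + χ * s₀‖, norm_pos_iff.2 fun h => ?_, fun s hs => hmin hs⟩
  have hs : s₀ ≠ 0 := by
    rintro rfl
    simp at h
  have hpos : 0 < s₀ := lt_of_le_of_ne hs₀.1 hs.symm
  have hsc : (s₀ : ℂ) ≠ 0 := by exact_mod_cast hs
  -- A zero of `1 + χ s₀` with `0 < s₀ ≤ 1` would put `χ = -1/s₀` on the cut.
  refine hχ (-1 / s₀) ?_ ?_
  · rw [div_le_iff₀ hpos]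
    linarith [hs₀.2]
  · push_cast
    rw [eq_div_iff hsc]
    linear_combination h

/-- The principal part `(1 + χ) I - χ 𝒟` of the Born operator is invertible. -/
theorem isUnit_principalPart {χ : ℂ} (hχ : ∀ x : ℝ, x ≤ -1 → χ ≠ (x : ℂ)) {V : Set R3}
    (hV : IsOpen V) :
    IsUnit ((1 + χ) • ContinuousLinearMap.id ℂ (L2 V) - χ • (restrictTo V ∘L dipoleOp hV)) := by
  obtain ⟨c, hc, hmin⟩ := exists_pos_le_norm_one_add_mul hχ
  -- Lax–Milgram: a lower bound `c ‖E‖²` on the modulus of the quadratic form suffices.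
  refine ContinuousLinearMap.isUnit_of_forall_le_norm_inner_map _ (c := ⟨c, hc.le⟩) hc fun E => ?_
  obtain ⟨t, h1, h2, h3⟩ := inner_restrictTo_dipoleOp hV E
  rw [norm_inner_symm]
  have hval : inner ℂ E (((1 + χ) • ContinuousLinearMap.id ℂ (L2 V) -
      χ • (restrictTo V ∘L dipoleOp hV)) E) = (1 + χ) * ((‖E‖ ^ 2 : ℝ) : ℂ) - χ * t := by
    have hEE : inner ℂ E E = ((‖E‖ ^ 2 : ℝ) : ℂ) := by
      rw [inner_self_eq_norm_sq_to_K]; simp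
    rw [sub_apply, smul_apply,
      smul_apply, ContinuousLinearMap.id_apply,
      ContinuousLinearMap.comp_apply, inner_sub_right, inner_smul_right, inner_smul_right, hEE, h1]
  rw [hval]
  change ‖E‖ ^ 2 * c ≤ _
  rcases eq_or_ne (‖E‖ ^ 2) 0 with h0 | h0
  · rw [h0, zero_mul]
    positivity
  have hpos : 0 < ‖E‖ ^ 2 := lt_of_le_of_ne (by positivity) h0.symm
  generalize ‖E‖ ^ 2 = n at *
  have hnc : (n : ℂ) ≠ 0 := by exact_mod_cast h0
  -- With `n = ‖E‖²`, this parameter satisfies `(1 + χ) n - χ t = n (1 + χ s)`; the bounds on `t`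
  -- place it in `[0, 1]`.
  have hs := hmin ((n - t) / n) ⟨div_nonneg (by linarith) hpos.le,
    (div_le_one hpos).2 (by linarith)⟩
  have he : (1 + χ) * (n : ℂ) - χ * t = n * (1 + χ * ((n - t) / n : ℝ)) := by
    push_cast
    field_simp
    ring
  rw [he, norm_mul, Complex.norm_real, Real.norm_of_nonneg hpos.le]
  gcongr

/-! ### The operator `γ` is a Hilbert–Schmidt operator -/

/-- Pointwise linearity, at every `r ∈ V` and not merely almost everywhere, makes `E ↦ (γE)(r)` a
genuine functional on `L²`. -/
theorem gammaField_add (k : ℝ) {V : Set R3} (hb : Bornology.IsBounded V) (E F : L2 V)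
    {r : R3} (hr : r ∈ V) :
    gammaField k V (E + F : L2 V) r = gammaField k V E r + gammaField k V F r := by
  rw [gammaField, gammaField, gammaField,
    ← integral_add (integrable_integrand k hb E hr) (integrable_integrand k hb F hr)]
  refine integral_congr_ae ?_
  filter_upwards [Lp.coeFn_add E F] with s hs
  rw [hs, Pi.add_apply, WithLp.ofLp_add, Matrix.mulVec_add, WithLp.toLp_add]

theorem gammaField_smul (k : ℝ) {V : Set R3} (c : ℂ) (E : L2 V) (r : R3) :
    gammaField k V (c • E : L2 V) r = c • gammaField k V E r := by
  rw [gammaField, gammaField, ← integral_smul]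
  refine integral_congr_ae ?_
  filter_upwards [Lp.coeFn_smul c E] with s hs
  rw [hs, Pi.smul_apply, WithLp.ofLp_smul, Matrix.mulVec_smul, WithLp.toLp_smul]

/-- Each component of `E ↦ (γE)(r)` is a functional of norm at most `M`, uniformly in `r ∈ V`.
Bessel's inequality for the three components gives `C = 3M²`, independent of the orthonormal family.
-/
theorem exists_sum_norm_gammaField_sq_le (k : ℝ) {V : Set R3} (hb : Bornology.IsBounded V) :
    ∃ C : ℝ, ∀ {ι : Type*} {v : ι → L2 V}, Orthonormal ℂ v → ∀ (s : Finset ι), ∀ r ∈ V,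
      ∑ i ∈ s, ‖gammaField k V (v i) r‖ ^ 2 ≤ C := by
  obtain ⟨M, hM⟩ := exists_norm_gammaField_le k hb
  refine ⟨∑ _j : Fin 3, (M : ℝ) ^ 2, fun {ι v} hv s r hr => ?_⟩
  let l : Fin 3 → L2 V →L[ℂ] ℂ := fun j => LinearMap.mkContinuous
    { toFun := fun E => gammaField k V E r j
      map_add' := fun E F => by rw [gammaField_add k hb E F hr, PiLp.add_apply]
      map_smul' := fun c E => by rw [gammaField_smul, PiLp.smul_apply, RingHom.id_apply] }
    M fun E => (PiLp.norm_apply_le _ j).trans (hM E r hr)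
  have hl : ∀ j, ‖l j‖ ≤ M := fun j => LinearMap.mkContinuous_norm_le _ M.2 _
  calc ∑ i ∈ s, ‖gammaField k V (v i) r‖ ^ 2 = ∑ j, ∑ i ∈ s, ‖l j (v i)‖ ^ 2 := by
        rw [Finset.sum_comm]
        exact Finset.sum_congr rfl fun i _ => EuclideanSpace.norm_sq_eq _
    _ ≤ ∑ _j : Fin 3, (M : ℝ) ^ 2 := by
        refine Finset.sum_le_sum fun j _ => (sum_norm_sq_apply_le hv s (l j)).trans ?_
        gcongr
        exact hl j

/-- The Hilbert–Schmidt property: the uniform pointwise bound is integrated over `V`, which has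
finite measure. -/
theorem summable_norm_gammaOp_sq (k : ℝ) {V : Set R3} (hV : IsOpen V)
    (hb : Bornology.IsBounded V) {ι : Type*} {v : ι → L2 V} (hv : Orthonormal ℂ v) :
    Summable fun i => ‖gammaOp k hV hb (v i)‖ ^ 2 := by
  obtain ⟨C, hC⟩ := exists_sum_norm_gammaField_sq_le k hb
  have : IsFiniteMeasure ((volume : Measure R3).restrict V) :=
    isFiniteMeasure_restrict.2 hb.measure_lt_top.ne
  refine summable_of_sum_le (c := ∫ _ in V, C) (fun i => by positivity) fun s => ?_
  have hae : ∀ i, gammaOp k hV hb (v i) =ᵐ[volume.restrict V] gammaField k V (v i) :=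
    fun i => (memLp_gammaField k hV hb (v i)).coeFn_toLp
  have hint : ∀ i, Integrable (fun r => ‖gammaField k V (v i) r‖ ^ 2) (volume.restrict V) :=
    fun i => (memLp_two_iff_integrable_sq_norm (memLp_gammaField k hV hb (v i)).1).1
      (memLp_gammaField k hV hb (v i))
  calc ∑ i ∈ s, ‖gammaOp k hV hb (v i)‖ ^ 2
      = ∑ i ∈ s, ∫ r in V, ‖gammaField k V (v i) r‖ ^ 2 := by
        refine Finset.sum_congr rfl fun i _ => ?_
        rw [norm_sq_eq_integral]
        exact integral_congr_ae ((hae i).mono fun r hr => by simp only [hr])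
    _ = ∫ r in V, ∑ i ∈ s, ‖gammaField k V (v i) r‖ ^ 2 :=
        (integral_finsetSum s fun i _ => hint i).symm
    _ ≤ ∫ _ in V, C :=
        setIntegral_mono_on (integrable_finsetSum s fun i _ => hint i) (integrable_const C)
          hV.measurableSet fun r hr => hC hv s r hr

end BornScattering

end

/-! ### The Born operator as a unit minus a finite-rank operator -/

theorem mainTheorem6 (k : ℝ) (hk : 0 < k) (χ : ℂ)
    (hχ : ∀ x : ℝ, x ≤ -1 → χ ≠ (x : ℂ))
    (V : Set BornScattering.R3) (hV : IsOpen V) (hb : Bornology.IsBounded V) :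
    (BornScattering.bornOp k χ hV hb).IsFredholm ∧
      BornScattering.fredholmIndex (BornScattering.bornOp k χ hV hb) = 0 := by
  obtain ⟨w, b, -⟩ := exists_hilbertBasis ℂ (BornScattering.L2 V)
  obtain ⟨ε, hε, hball⟩ := Metric.isOpen_iff.1 Units.isOpen _
    (BornScattering.isUnit_principalPart hχ hV)
  obtain ⟨F, hF, hFε⟩ := BornScattering.exists_finiteRank_norm_sub_le b
    (χ • BornScattering.gammaOp k hV hb)
    (by simpa [norm_smul, mul_pow] using
      (BornScattering.summable_norm_gammaOp_sq k hV hb b.orthonormal).mul_left (‖χ‖ ^ 2))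
    (half_pos hε)
  -- The unit `a` differs from the principal part by `-(χγ - F)`, of norm at most `ε/2 < ε`, so it
  -- stays in the ball of units; and the Born operator minus `a` is `-F`.
  refine BornScattering.isFredholm_and_fredholmIndex_eq_zero
    (a := BornScattering.bornOp k χ hV hb + F) (hball ?_) ?_
  · rw [Metric.mem_ball, dist_eq_norm, BornScattering.bornOp]
    refine lt_of_le_of_lt (le_of_eq_of_le ?_ hFε) (half_lt_self hε)
    rw [← norm_neg]
    congr 1
    abel
  · rw [sub_add_cancel_left]
    exact hF.neg
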